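/- **Conventions.** Let $(\mathcal C,\otimes,1)$ be a monoidal category. An object $K$ is *dualizing* if for every $Y$ the functor $\operatorname{Hom}(-\otimes Y,K)$ is representable by an object $DY$ and the induced contravariant functor $D$ on $\mathcal C$ is an antiequivalence; a *GV-category* is a monoidal category with a chosen dualizing object. Every GV-category is closed: $X\otimes -$ has a right adjoint $X\multimap -$ (counit $\mathrm{ev}$, unit $\mathrm{coev}$), and $-\otimes X$ has a right adjoint $[X,-]_r$ (the right internal hom). Write $D'(X):=X\multimap K$. A *braided GV-category* is a GV-category with a braiding $c$ on its underlying monoidal category. A *GV-functor* between GV-categories $(\mathcal C,K)$ and $(\mathcal D,k)$ is a lax monoidal functor $F\colon\mathcal C\to\mathcal D$ (with structure maps $\varphi^2_{X,Y}\colon FX\otimes FY\to F(X\otimes Y)$ and $\varphi^0$) with a morphism $\upsilon\colon F(K)\to k$ such that for all $X$ the two duality transformations $$F(X\multimap K)\to FX\multimap F(K)\xrightarrow{FX\,\multimap\,\upsilon}FX\multimap k,\qquad F([X,K]_r)\to [FX,F(K)]_r\xrightarrow{[FX,\,\upsilon]_r}[FX,k]_r$$ are invertible; here the first arrows are the transposes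 of $F(\mathrm{ev})\circ\varphi^2\colon FX\otimes F(X\multimap K)\to F(K)$ and of its right-handed analogue $F([X,K]_r)\otimes FX\to F(K)$. **Proposition.** Let $(\mathcal C,\otimes,1,c,K)$ be a braided GV-category whose underlying category has equalizers and coequalizers, and let $A=(A,\mu,\eta)$ be a commutative algebra in $\mathcal C$ (unital, associative, $\mu\circ c_{A,A}=\mu$). Let ${}_A\mathcal C$ be the category of left $A$-modules, with the monoidal structure whose unit is $A$ and whose product $M\otimes_A N$ is the coequalizer of the two maps $M\otimes A\otimes N\rightrightarrows M\otimes N$ given by the left action $l^N$ of $A$ on $N$ and the right action $l^M\circ c_{M,A}$ on $M$. Equip $D'(A)=A\multimap K$ with the left $A$-action induced by the multiplication, $$A\otimes(A\multimap K)\xrightarrow{\ \underline{\mu}\,\otimes\,\mathrm{id}\ }(A\multimap A)\otimes(A\multimap K)\xrightarrow{\ \mathrm{comp}\ }A\multimap K,\qquad \underline\mu=(A\multimap\mu)\circ\mathrm{coev}^A_A,$$ where $\mathrm{comp}$ is internal composition. Then the $A$-module $D'(A)$ is a dualizing object of ${}_A\mathcal C$, so that $({}_A\mathcal C,\otimes_A,A,D'(A))$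 is a GV-category. Moreover, the forgetful functor ${}_A\mathcal C\to\mathcal C$, with the lax monoidal structure given by the projections $M\otimes N\to M\otimes_A N$ and by $\eta\colon 1\to A$, is a GV-functor with respect to the morphism $\upsilon\colon D'(A)=A\multimap K\xrightarrow{\eta\,\multimap\,K}1\multimap K\cong K$. (Applying this to the inverse braiding, for which $A$ is again commutative, one gets the same for the monoidal structure defined with $c_{A,M}^{-1}$ in place of $c_{M,A}$.) -/

import Mathlib

open CategoryTheory MonoidalCategory Limits Opposite

universe v u v₁ u₁ v₂ u₂

namespace GrothendieckVerdier

/-! ### Dualizing objects and GV-categories -/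

section Dualizing

variable {C : Type u} [Category.{v} C] [MonoidalCategory C]

/-- The functor `Y ↦ Hom(- ⊗ Y, K)` from `Cᵒᵖ` to presheaves on `C`. -/
def pairings (K : C) : Cᵒᵖ ⥤ Cᵒᵖ ⥤ Type v where
  obj Y := (tensorRight Y.unop).op ⋙ yoneda.obj K
  map f := Functor.whiskerRight (NatTrans.op ((tensoringRight C).map f.unop)) (yoneda.obj K)

/-- `K` is a dualizing object: every `Hom(- ⊗ Y, K)` is representable by an object `D Y`
(naturally in `Y`, which determines the contravariant functor `D` up to isomorphism), and
the induced contravariant functor `D` is an antiequivalence. -/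
def IsDualizing (K : C) : Prop :=
  ∃ D : Cᵒᵖ ⥤ C, Nonempty (D ⋙ yoneda ≅ pairings K) ∧ D.IsEquivalence

end Dualizing

/-- A GV-category: a monoidal category with a chosen dualizing object. -/
class GVCategory (C : Type u) [Category.{v} C] [MonoidalCategory C] where
  /-- the dualizing object -/
  dualizingObj : C
  isDualizing : IsDualizing dualizingObj

/-- A right closed structure: right adjoints `Y ↦ Y ⟜ X` of the functors `- ⊗ X`.
(Mathlib's `MonoidalClosed` provides the right adjoints `Y ↦ X ⊸ Y` of `X ⊗ -`.) -/
class RightClosed (C : Type u) [Category.{v} C] [MonoidalCategory C] where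
  /-- `(rightHom X).obj Y` is the right internal hom `Y ⟜ X` -/
  rightHom : C → C ⥤ C
  /-- the adjunction between `- ⊗ X` and `- ⟜ X` -/
  rightAdj (X : C) : tensorRight X ⊣ rightHom X

section Closed

variable {C : Type u} [Category.{v} C] [MonoidalCategory C]

theorem nonempty_rightClosed {K : C} (hK : IsDualizing K) : Nonempty (RightClosed C) := by
  obtain ⟨D, ⟨e⟩, hD⟩ := hK
  -- `Hom(X ⊗ Y, K) ≃ Hom(X, D Y)`, natural in `X`
  let E (Y X : C) : (X ⟶ D.obj (op Y)) ≃ (X ⊗ Y ⟶ K) := ((e.app (op Y)).app (op X)).toEquiv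
  have hE (Y : C) {X X' : C} (f : X ⟶ X') (g : X' ⟶ D.obj (op Y)) :
      E Y X (f ≫ g) = f ▷ Y ≫ E Y X' g :=
    ConcreteCategory.congr_hom ((e.hom.app (op Y)).naturality f.op) g
  have hE' (Y : C) {X X' : C} (f : X ⟶ X') (g : X' ⊗ Y ⟶ K) :
      (E Y X).symm (f ▷ Y ≫ g) = f ≫ (E Y X').symm g := by
    rw [Equiv.symm_apply_eq, hE, Equiv.apply_symm_apply]
  let W (Z : C) : C := (D.objPreimage Z).unop
  let w (Z : C) : D.obj (op (W Z)) ≅ Z := D.objObjPreimageIso Z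
  let Φ (X Y Z : C) : ((tensorRight X).obj Y ⟶ Z) ≃ (Y ⟶ D.obj (op (X ⊗ W Z))) :=
    ((w Z).symm.homToEquiv).trans <| (E (W Z) (Y ⊗ X)).trans <|
      ((α_ Y X (W Z)).homFromEquiv).trans (E (X ⊗ W Z) Y).symm
  refine ⟨⟨fun X => Adjunction.rightAdjointOfEquiv (F := tensorRight X)
    (G_obj := fun Z => D.obj (op (X ⊗ W Z))) (Φ X) ?_, fun X =>
      Adjunction.adjunctionOfEquivRight _ _⟩⟩
  intro Y' Y Z f g
  simp only [Φ, Equiv.trans_apply, Iso.homToEquiv_apply, Iso.homFromEquiv_apply]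
  rw [← hE']
  congr 1
  simp [hE]

theorem nonempty_monoidalClosed {K : C} (hK : IsDualizing K) : Nonempty (MonoidalClosed C) := by
  obtain ⟨D, ⟨e⟩, hD⟩ := hK
  let E (Y X : C) : (X ⟶ D.obj (op Y)) ≃ (X ⊗ Y ⟶ K) := ((e.app (op Y)).app (op X)).toEquiv
  have hE (Y : C) {X X' : C} (f : X ⟶ X') (g : X' ⟶ D.obj (op Y)) :
      E Y X (f ≫ g) = f ▷ Y ≫ E Y X' g :=
    ConcreteCategory.congr_hom ((e.hom.app (op Y)).naturality f.op) g
  have hN {Y Y' : C} (X : C) (f : Y' ⟶ Y) (g : X ⟶ D.obj (op Y)) :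
      E Y' X (g ≫ D.map f.op) = X ◁ f ≫ E Y X g :=
    ConcreteCategory.congr_hom (NatTrans.congr_app (e.hom.naturality f.op) (op X)) g
  have hN' {Y Y' : C} (X : C) (f : Y' ⟶ Y) (g : X ⊗ Y ⟶ K) :
      (E Y' X).symm (X ◁ f ≫ g) = (E Y X).symm g ≫ D.map f.op := by
    rw [Equiv.symm_apply_eq, hN, Equiv.apply_symm_apply]
  let V (X Z : C) : C := (D.objPreimage (D.obj (op Z) ⊗ X)).unop
  let w (X Z : C) : D.obj (op (V X Z)) ≅ D.obj (op Z) ⊗ X := D.objObjPreimageIso _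
  let F (X Y : C) : (X ⟶ Y) ≃ (D.obj (op Y) ⟶ D.obj (op X)) :=
    (opEquiv (op Y) (op X)).symm.trans (Functor.FullyFaithful.ofFullyFaithful D).homEquiv
  have hF {X X' Y : C} (f : X ⟶ X') (g : X' ⟶ Y) : F X Y (f ≫ g) = F X' Y g ≫ D.map f.op :=
    D.map_comp g.op f.op
  have hF' {X X' Y : C} (f : X ⟶ X') (g : D.obj (op Y) ⟶ D.obj (op X')) :
      (F X Y).symm (g ≫ D.map f.op) = f ≫ (F X' Y).symm g := by
    rw [Equiv.symm_apply_eq, hF, Equiv.apply_symm_apply]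
  let Φ (X Y Z : C) : ((tensorLeft X).obj Y ⟶ Z) ≃ (Y ⟶ V X Z) :=
    (F (X ⊗ Y) Z).trans <| (E (X ⊗ Y) (D.obj (op Z))).trans <|
      ((α_ (D.obj (op Z)) X Y).symm.homFromEquiv).trans <|
        (E Y (D.obj (op Z) ⊗ X)).symm.trans <|
          ((w X Z).symm.homFromEquiv).trans (F Y (V X Z)).symm
  have hΦ (X Y' Y Z : C) (f : Y' ⟶ Y) (g : (tensorLeft X).obj Y ⟶ Z) :
      Φ X Y' Z ((tensorLeft X).map f ≫ g) = f ≫ Φ X Y Z g := by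
    simp only [Φ, Equiv.trans_apply, Iso.homFromEquiv_apply]
    rw [← hF']
    congr 1
    rw [Category.assoc, ← hN']
    congr 2
    have h : F (X ⊗ Y') Z ((tensorLeft X).map f ≫ g) = F (X ⊗ Y) Z g ≫ D.map (X ◁ f).op :=
      hF _ _
    simp only [Iso.symm_inv]
    erw [h, hN]
    simp
  exact ⟨⟨fun X => ⟨Adjunction.rightAdjointOfEquiv (F := tensorLeft X) (G_obj := V X) (Φ X)
    (fun Y' Y Z f g => hΦ X Y' Y Z f g), Adjunction.adjunctionOfEquivRight _ _⟩⟩⟩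

end Closed

noncomputable instance (C : Type u) [Category.{v} C] [MonoidalCategory C] [GVCategory C] :
    MonoidalClosed C :=
  (nonempty_monoidalClosed (GVCategory.isDualizing (C := C))).some

noncomputable instance (C : Type u) [Category.{v} C] [MonoidalCategory C] [GVCategory C] :
    RightClosed C :=
  (nonempty_rightClosed (GVCategory.isDualizing (C := C))).some

instance {C : Type u} [Category.{v} C] [MonoidalCategory C] [MonoidalClosed C] (X : C) :
    PreservesColimitsOfSize.{0, 0} (tensorLeft X) :=
  (ihom.adjunction X).leftAdjoint_preservesColimits

instance {C : Type u} [Category.{v} C] [MonoidalCategory C] [RightClosed C] (X : C) :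
    PreservesColimitsOfSize.{0, 0} (tensorRight X) :=
  (RightClosed.rightAdj X).leftAdjoint_preservesColimits

/-! ### GV-functors -/

section Functors

variable {C : Type u₁} [Category.{v₁} C] [MonoidalCategory C]
  {D : Type u₂} [Category.{v₂} D] [MonoidalCategory D] (F : C ⥤ D) [F.LaxMonoidal]

/-- The left comparator `F (X ⊸ Y) ⟶ F X ⊸ F Y`. -/
def leftComparator [MonoidalClosed C] [MonoidalClosed D] (X Y : C) :
    F.obj ((ihom X).obj Y) ⟶ (ihom (F.obj X)).obj (F.obj Y) :=
  (ihom.coev (F.obj X)).app (F.obj ((ihom X).obj Y)) ≫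
    (ihom (F.obj X)).map
      (Functor.LaxMonoidal.μ F X ((ihom X).obj Y) ≫ F.map ((ihom.ev X).app Y))

/-- The right comparator `F (Y ⟜ X) ⟶ F Y ⟜ F X`. -/
def rightComparator [RightClosed C] [RightClosed D] (Y X : C) :
    F.obj ((RightClosed.rightHom X).obj Y) ⟶
      (RightClosed.rightHom (F.obj X)).obj (F.obj Y) :=
  (RightClosed.rightAdj (F.obj X)).unit.app (F.obj ((RightClosed.rightHom X).obj Y)) ≫
    (RightClosed.rightHom (F.obj X)).map
      (Functor.LaxMonoidal.μ F ((RightClosed.rightHom X).obj Y) X ≫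
        F.map ((RightClosed.rightAdj X).counit.app Y))

/-- The left duality transformation `F (X ⊸ K) ⟶ F X ⊸ k` of a form `υ : F K ⟶ k`. -/
def leftDuality [MonoidalClosed C] [MonoidalClosed D] {K : C} {k : D} (υ : F.obj K ⟶ k) (X : C) :
    F.obj ((ihom X).obj K) ⟶ (ihom (F.obj X)).obj k :=
  leftComparator F X K ≫ (ihom (F.obj X)).map υ

/-- The right duality transformation `F (K ⟜ X) ⟶ k ⟜ F X` of a form `υ : F K ⟶ k`. -/
def rightDuality [RightClosed C] [RightClosed D] {K : C} {k : D} (υ : F.obj K ⟶ k) (X : C) :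
    F.obj ((RightClosed.rightHom X).obj K) ⟶ (RightClosed.rightHom (F.obj X)).obj k :=
  rightComparator F K X ≫ (RightClosed.rightHom (F.obj X)).map υ

/-- A lax monoidal functor `F` between GV-categories together with a form `υ : F K ⟶ k` is a
GV-functor if `υ` is a Frobenius form: both its duality transformations are invertible. -/
structure IsGVFunctor [GVCategory C] [GVCategory D]
    (υ : F.obj (GVCategory.dualizingObj (C := C)) ⟶ GVCategory.dualizingObj (C := D)) :
    Prop where
  isIso_leftDuality (X : C) : IsIso (leftDuality F υ X)
  isIso_rightDuality (X : C) : IsIso (rightDuality F υ X)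

end Functors

/-! ### The monoidal category of modules over a commutative algebra -/

section Bimodules

variable {C : Type u} [Category.{v} C] [MonoidalCategory C] [HasCoequalizers C]
  [∀ X : C, PreservesColimitsOfSize.{0, 0} (tensorLeft X)]
  [∀ X : C, PreservesColimitsOfSize.{0, 0} (tensorRight X)]

/-- The monoidal category of `A`-bimodules: `M ⊗_A N` is the coequalizer of the two maps
`(M ⊗ A) ⊗ N ⟶ M ⊗ N`, and the unit is `A`. -/
noncomputable instance bimodMonoidalCategory (A : Mon C) : MonoidalCategory (Bimod A A) where
  tensorObj M N := M.tensorBimod N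
  tensorUnit := Bimod.regular A
  whiskerLeft M _ _ f := Bimod.whiskerLeft M f
  whiskerRight f N := Bimod.whiskerRight f N
  tensorHom {M₁ N₁ M₂ N₂} f g := Bimod.whiskerRight f M₂ ≫ Bimod.whiskerLeft N₁ g
  associator := Bimod.associatorBimod
  leftUnitor := Bimod.leftUnitorBimod
  rightUnitor := Bimod.rightUnitorBimod
  tensorHom_def _ _ := rfl
  id_tensorHom_id _ _ := by
    rw [Bimod.whiskerLeft_id_bimod, Bimod.id_whiskerRight_bimod, Category.comp_id]
  tensorHom_comp_tensorHom f₁ f₂ g₁ g₂ := by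
    rw [Bimod.comp_whiskerRight_bimod, Bimod.whiskerLeft_comp_bimod]
    simp only [Category.assoc]
    rw [← Category.assoc (Bimod.whiskerLeft _ f₂), Bimod.whisker_exchange_bimod, Category.assoc]
  whiskerLeft_id _ _ := Bimod.whiskerLeft_id_bimod
  id_whiskerRight _ _ := Bimod.id_whiskerRight_bimod
  associator_naturality {M₁ M₂ M₃ N₁ N₂ N₃} f₁ f₂ f₃ := by
    rw [Bimod.comp_whiskerRight_bimod, Bimod.whiskerLeft_comp_bimod,
      Bimod.whisker_assoc_bimod, Bimod.comp_whiskerLeft_bimod, Bimod.whiskerRight_comp_bimod]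
    simp only [Category.assoc, Iso.inv_hom_id, Category.comp_id, Iso.inv_hom_id_assoc,
      Iso.hom_inv_id_assoc]
  leftUnitor_naturality f := by
    rw [Bimod.id_whiskerLeft_bimod]
    simp only [Category.assoc, Iso.inv_hom_id, Category.comp_id]
  rightUnitor_naturality f := by
    rw [Bimod.whiskerRight_id_bimod]
    simp only [Category.assoc, Iso.inv_hom_id, Category.comp_id]
  pentagon := Bimod.pentagon_bimod
  triangle := Bimod.triangle_bimod


variable {A : Mon C} (P Q L : Bimod A A)

/-- The canonical projection `P ⊗ Q ⟶ P ⊗_A Q`. -/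
noncomputable def proj : P.X ⊗ Q.X ⟶ (P ⊗ Q).X :=
  coequalizer.π (P.actRight ▷ Q.X) ((α_ _ _ _).hom ≫ (P.X ◁ Q.actLeft))

theorem proj_condition :
    P.actRight ▷ Q.X ≫ proj P Q = (α_ P.X A.X Q.X).hom ≫ P.X ◁ Q.actLeft ≫ proj P Q :=
  (coequalizer.condition _ _).trans (Category.assoc _ _ _)

instance : Epi (proj P Q) := coequalizer.π_epi

instance (X : C) : Epi (proj P Q ▷ X) :=
  inferInstanceAs (Epi ((tensorRight X).map (coequalizer.π _ _)))

instance (X : C) : Epi (X ◁ proj P Q) :=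
  inferInstanceAs (Epi ((tensorLeft X).map (coequalizer.π _ _)))

theorem proj_actLeft :
    A.X ◁ proj P Q ≫ (P ⊗ Q).actLeft =
      (α_ A.X P.X Q.X).inv ≫ P.actLeft ▷ Q.X ≫ proj P Q :=
  Bimod.TensorBimod.whiskerLeft_π_actLeft P Q

theorem proj_actRight :
    proj P Q ▷ A.X ≫ (P ⊗ Q).actRight =
      (α_ P.X Q.X A.X).hom ≫ P.X ◁ Q.actRight ≫ proj P Q :=
  Bimod.TensorBimod.π_tensor_id_actRight P Q

variable {P Q} in
theorem proj_whiskerRight (f : P ⟶ Q) :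
    proj P L ≫ (f ▷ L).hom = f.hom ▷ L.X ≫ proj Q L :=
  ι_colimMap _ WalkingParallelPair.one

variable {Q L} in
theorem proj_whiskerLeft (f : Q ⟶ L) :
    proj P Q ≫ (P ◁ f).hom = P.X ◁ f.hom ≫ proj P L :=
  ι_colimMap _ WalkingParallelPair.one

theorem proj_associator :
    proj P Q ▷ L.X ≫ proj (P ⊗ Q) L ≫ (α_ P Q L).hom.hom =
      (α_ P.X Q.X L.X).hom ≫ P.X ◁ proj Q L ≫ proj P (Q ⊗ L) := by
  have h : proj (P ⊗ Q) L ≫ (α_ P Q L).hom.hom = Bimod.AssociatorBimod.homAux P Q L :=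
    coequalizer.π_desc _ _
  rw [h]
  exact π_tensor_id_preserves_coequalizer_inv_desc _ _ _ _

theorem proj_leftUnitor : proj (𝟙_ (Bimod A A)) P ≫ (λ_ P).hom.hom = P.actLeft :=
  coequalizer.π_desc _ _

theorem proj_rightUnitor : proj P (𝟙_ (Bimod A A)) ≫ (ρ_ P).hom.hom = P.actRight :=
  coequalizer.π_desc _ _

/-- The lax monoidal structure on the forgetful functor from `A`-bimodules, given by the unit
of `A` and the canonical projections. -/
noncomputable instance : (Bimod.forget (A := A) (B := A)).LaxMonoidal where
  ε := (MonObj.one : 𝟙_ C ⟶ A.X)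
  μ P Q := proj P Q
  μ_natural_left f L := (proj_whiskerRight L f).symm
  μ_natural_right P f := (proj_whiskerLeft P f).symm
  associativity P Q L := proj_associator P Q L
  left_unitality P := by
    refine P.one_actLeft.symm.trans ?_
    exact congrArg (_ ≫ ·) (proj_leftUnitor P).symm
  right_unitality P := by
    refine P.actRight_one.symm.trans ?_
    exact congrArg (_ ≫ ·) (proj_rightUnitor P).symm

end Bimodules

section Modules

variable {C : Type u} [Category.{v} C] [MonoidalCategory C] {A : C} [MonObj A]

/-- The left action of a module. -/
def leftAct (M : Mod C A) : A ⊗ M.X ⟶ M.X := ModObj.smul (M := A) (X := M.X)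

theorem one_leftAct (M : Mod C A) : (MonObj.one : 𝟙_ C ⟶ A) ▷ M.X ≫ leftAct M = (λ_ M.X).hom :=
  ModObj.one_smul_self A M.X

theorem mul_leftAct (M : Mod C A) :
    (MonObj.mul : A ⊗ A ⟶ A) ▷ M.X ≫ leftAct M = (α_ A A M.X).hom ≫ A ◁ leftAct M ≫ leftAct M :=
  ModObj.mul_smul_self A M.X

theorem leftAct_hom {M N : Mod C A} (f : M ⟶ N) :
    leftAct M ≫ f.hom = A ◁ f.hom ≫ leftAct N :=
  IsModHom.smul_hom (A := A) (f := f.hom)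

variable [BraidedCategory C]

/-- The right action `M ⊗ A ⟶ A ⊗ M ⟶ M` on a left module `M`, induced by the braiding. -/
def rightAct (M : Mod C A) : M.X ⊗ A ⟶ M.X := (β_ M.X A).hom ≫ leftAct M

variable (A) [IsCommMonObj A]

/-- A left module over a commutative algebra, seen as a bimodule with the right action induced
by the braiding. -/
@[simps]
def toBimod : Mod C A ⥤ Bimod (Mon.mk A) (Mon.mk A) where
  obj M :=
    { X := M.X
      actLeft := leftAct M
      actRight := rightAct M
      one_actLeft := one_leftAct M
      left_assoc := mul_leftAct M
      actRight_one := by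
        dsimp only [rightAct]
        rw [BraidedCategory.braiding_naturality_right_assoc, one_leftAct]
        simp
      right_assoc := by
        dsimp only [rightAct]
        rw [BraidedCategory.braiding_naturality_right_assoc, comp_whiskerRight, Category.assoc,
          BraidedCategory.braiding_naturality_left_assoc, BraidedCategory.braiding_tensor_left_hom,
          BraidedCategory.braiding_tensor_right_hom]
        simp only [Category.assoc]
        rw [← mul_leftAct, ← comp_whiskerRight_assoc, IsCommMonObj.mul_comm]
      middle_assoc := by
        dsimp only [rightAct]
        rw [BraidedCategory.braiding_naturality_left_assoc,
          BraidedCategory.braiding_tensor_left_hom]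
        simp only [Category.assoc, MonoidalCategory.whiskerLeft_comp]
        rw [← mul_leftAct, ← comp_whiskerRight_assoc, IsCommMonObj.mul_comm, mul_leftAct,
          Iso.inv_hom_id_assoc] }
  map f :=
    { hom := f.hom
      left_act_hom := leftAct_hom f
      right_act_hom := by
        dsimp only [rightAct]
        rw [Category.assoc, leftAct_hom, BraidedCategory.braiding_naturality_left_assoc] }

instance : (toBimod A).Faithful where
  map_injective h := Mod.hom_ext _ _ (congrArg Bimod.Hom.hom h)

/-- The left module underlying a bimodule. -/
@[simps]
def toLeftMod : Bimod (Mon.mk A) (Mon.mk A) ⥤ Mod C A where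
  obj M :=
    { X := M.X
      mod := { smul := M.actLeft, one_smul := M.one_actLeft, mul_smul := M.left_assoc } }
  map f := Mod.Hom.mk' f.hom f.left_act_hom

variable [HasCoequalizers C]
  [∀ X : C, PreservesColimitsOfSize.{0, 0} (tensorLeft X)]
  [∀ X : C, PreservesColimitsOfSize.{0, 0} (tensorRight X)]

/-- On `M ⊗_A N` the right action of `N` agrees with the one obtained from the left action
by the braiding. -/
theorem tensor_actRight (M N : Mod C A) :
    ((toBimod A).obj M ⊗ (toBimod A).obj N).actRight =
      (β_ ((toBimod A).obj M ⊗ (toBimod A).obj N).X A).hom ≫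
        ((toBimod A).obj M ⊗ (toBimod A).obj N).actLeft := by
  rw [← cancel_epi (proj ((toBimod A).obj M) ((toBimod A).obj N) ▷ A)]
  refine (proj_actRight _ _).trans ?_
  rw [BraidedCategory.braiding_naturality_left_assoc]
  refine Eq.trans ?_ (congrArg (_ ≫ ·)
    (proj_actLeft ((toBimod A).obj M) ((toBimod A).obj N)).symm)
  have h := proj_condition ((toBimod A).obj M) ((toBimod A).obj N)
  have e : ((toBimod A).obj M).actRight =
      (β_ ((toBimod A).obj M).X A).hom ≫ ((toBimod A).obj M).actLeft := rfl
  have e' : ((toBimod A).obj N).actRight =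
      (β_ ((toBimod A).obj N).X A).hom ≫ ((toBimod A).obj N).actLeft := rfl
  rw [e] at h
  rw [e', BraidedCategory.braiding_tensor_left_hom]
  simp only [comp_whiskerRight, Category.assoc,
    MonoidalCategory.whiskerLeft_comp] at h ⊢
  rw [Iso.hom_inv_id_assoc, h, Iso.inv_hom_id_assoc]

/-- The bimodule `M ⊗_A N` is the one determined by its underlying left module. -/
noncomputable def tensorIso (M N : Mod C A) :
    (toBimod A).obj M ⊗ (toBimod A).obj N ≅
      (toBimod A).obj ((toLeftMod A).obj ((toBimod A).obj M ⊗ (toBimod A).obj N)) :=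
  Bimod.isoOfIso (Iso.refl _)
    ((Category.comp_id _).trans
      ((congrArg (· ≫ _) (MonoidalCategory.whiskerLeft_id _ _)).trans (Category.id_comp _)).symm)
    ((Category.comp_id _).trans <| (tensor_actRight A M N).trans
      ((congrArg (· ≫ _) (MonoidalCategory.id_whiskerRight _ _)).trans (Category.id_comp _)).symm)

/-- The regular bimodule is the one determined by the regular left module. -/
noncomputable def unitIso :
    𝟙_ (Bimod (Mon.mk A) (Mon.mk A)) ≅ (toBimod A).obj (Mod.regular A) :=
  Bimod.isoOfIso (Iso.refl _)
    ((Category.comp_id _).trans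
      ((congrArg (· ≫ _) (MonoidalCategory.whiskerLeft_id _ _)).trans (Category.id_comp _)).symm)
    ((Category.comp_id _).trans <| (IsCommMonObj.mul_comm A).symm.trans
      ((congrArg (· ≫ _) (MonoidalCategory.id_whiskerRight _ _)).trans (Category.id_comp _)).symm)

noncomputable instance modMonoidalCategoryStruct : MonoidalCategoryStruct (Mod C A) where
  tensorObj M N := (toLeftMod A).obj ((toBimod A).obj M ⊗ (toBimod A).obj N)
  tensorUnit := Mod.regular A
  whiskerLeft M _ _ f := (toLeftMod A).map ((toBimod A).obj M ◁ (toBimod A).map f)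
  whiskerRight f N := (toLeftMod A).map ((toBimod A).map f ▷ (toBimod A).obj N)
  tensorHom f g := (toLeftMod A).map ((toBimod A).map f ⊗ₘ (toBimod A).map g)
  associator M N P := (toLeftMod A).mapIso
    (((tensorIso A M N).symm ⊗ᵢ Iso.refl _) ≪≫ α_ _ _ _ ≪≫ (Iso.refl _ ⊗ᵢ tensorIso A N P))
  leftUnitor M := (toLeftMod A).mapIso (((unitIso A).symm ⊗ᵢ Iso.refl ((toBimod A).obj M)) ≪≫ λ_ _)
  rightUnitor M := (toLeftMod A).mapIso ((Iso.refl ((toBimod A).obj M) ⊗ᵢ (unitIso A).symm) ≪≫ ρ_ _)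

/-- The tensor product of modules is computed by the inclusion into bimodules. -/
noncomputable def inducingData : Monoidal.InducingFunctorData (toBimod A) where
  μIso := tensorIso A
  εIso := unitIso A
  whiskerLeft_eq M _ _ f := by
    apply Bimod.hom_ext
    exact ((Category.id_comp _).trans (Category.comp_id _)).symm
  whiskerRight_eq f N := by
    apply Bimod.hom_ext
    exact ((Category.id_comp _).trans (Category.comp_id _)).symm
  tensorHom_eq f g := by
    apply Bimod.hom_ext
    exact ((Category.id_comp _).trans (Category.comp_id _)).symm
  associator_eq M N P := by
    apply Bimod.hom_ext
    exact (congrArg₂ (· ≫ ·) (Category.id_comp _)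
      (congrArg (_ ≫ ·) (Category.comp_id _))).symm
  leftUnitor_eq M := by
    apply Bimod.hom_ext
    exact (congrArg (· ≫ _) (Category.id_comp _)).symm
  rightUnitor_eq M := by
    apply Bimod.hom_ext
    exact (congrArg (· ≫ _) (Category.id_comp _)).symm

/-- For a commutative algebra `A`, the monoidal category of left `A`-modules with the relative
tensor product `⊗_A`, the right actions being induced by the braiding. -/
noncomputable instance modMonoidalCategory : MonoidalCategory (Mod C A) :=
  Monoidal.induced (toBimod A) (inducingData A)

/-- The canonical projection `M ⊗ N ⟶ M ⊗_A N`: the coequalizer of the maps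
`(M ⊗ A) ⊗ N ⟶ M ⊗ N` given by the right action of `M` and the left action of `N`. -/
noncomputable def modProj (M N : Mod C A) : M.X ⊗ N.X ⟶ (M ⊗ N).X :=
  coequalizer.π (rightAct M ▷ N.X) ((α_ M.X A N.X).hom ≫ M.X ◁ leftAct N)

/-- The inclusion of left modules into bimodules is strong monoidal. -/
noncomputable instance : (toBimod A).Monoidal :=
  Monoidal.fromInducedMonoidal (toBimod A) (inducingData A)

theorem toBimod_forget_μ (M N : Mod C A) :
    Functor.LaxMonoidal.μ (toBimod A ⋙ Bimod.forget _) M N = modProj A M N :=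
  Category.comp_id _

theorem toBimod_forget_ε :
    Functor.LaxMonoidal.ε (toBimod A ⋙ Bimod.forget _) = (MonObj.one : 𝟙_ C ⟶ A) :=
  Category.comp_id _

/-- The lax monoidal structure on the forgetful functor from left `A`-modules, given by the unit
of `A` and the canonical projections `M ⊗ N ⟶ M ⊗_A N`. -/
noncomputable instance : (Mod.forget (D := C) A).LaxMonoidal where
  ε := (MonObj.one : 𝟙_ C ⟶ A)
  μ M N := modProj A M N
  μ_natural_left f N := (proj_whiskerRight ((toBimod A).obj N) ((toBimod A).map f)).symm
  μ_natural_right M f := (proj_whiskerLeft ((toBimod A).obj M) ((toBimod A).map f)).symm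
  associativity M N P := by
    have h := Functor.LaxMonoidal.associativity (toBimod A ⋙ Bimod.forget _) M N P
    rw [toBimod_forget_μ, toBimod_forget_μ, toBimod_forget_μ, toBimod_forget_μ] at h
    exact h
  left_unitality M := by
    have h := Functor.LaxMonoidal.left_unitality (toBimod A ⋙ Bimod.forget _) M
    rw [toBimod_forget_μ, toBimod_forget_ε] at h
    exact h
  right_unitality M := by
    have h := Functor.LaxMonoidal.right_unitality (toBimod A ⋙ Bimod.forget _) M
    rw [toBimod_forget_μ, toBimod_forget_ε] at h
    exact h

end Modules

/-! ### The dual of an algebra -/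

section DualModule

variable {C : Type u} [Category.{v} C] [MonoidalCategory C] [MonoidalClosed C]
  (A : C) [MonObj A] (K : C)

/-- The left action of `A` on `A ⊸ K` induced by the multiplication of `A`: the morphism
`A ⟶ A ⊸ A` corresponding to the multiplication, followed by internal composition
`(A ⊸ A) ⊗ (A ⊸ K) ⟶ A ⊸ K`. -/
def dualAct : A ⊗ (ihom A).obj K ⟶ (ihom A).obj K :=
  ((ihom.coev A).app A ≫ (ihom A).map (MonObj.mul : A ⊗ A ⟶ A)) ▷ (ihom A).obj K ≫
    MonoidalClosed.comp A A K

theorem ev_dualAct :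
    A ◁ dualAct A K ≫ (ihom.ev A).app K =
      (α_ A A ((ihom A).obj K)).inv ≫ (MonObj.mul : A ⊗ A ⟶ A) ▷ (ihom A).obj K ≫
        (ihom.ev A).app K := by
  rw [dualAct, ← MonoidalClosed.curry_eq, MonoidalCategory.whiskerLeft_comp, Category.assoc,
    MonoidalClosed.comp_eq, MonoidalClosed.whiskerLeft_curry_ihom_ev_app,
    MonoidalClosed.compTranspose_eq, associator_inv_naturality_middle_assoc,
    ← comp_whiskerRight_assoc, MonoidalClosed.whiskerLeft_curry_ihom_ev_app]
  rfl

theorem ihom_hom_ext {X Y Z : C} {f g : Z ⟶ (ihom X).obj Y}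
    (h : X ◁ f ≫ (ihom.ev X).app Y = X ◁ g ≫ (ihom.ev X).app Y) : f = g :=
  MonoidalClosed.uncurry_injective h

/-- The left `A`-module `D' A = A ⊸ K`, with the action induced by the multiplication of `A`. -/
def dualModule : Mod C A where
  X := (ihom A).obj K
  mod :=
    { smul := dualAct A K
      one_smul := by
        change (MonObj.one : 𝟙_ C ⟶ A) ▷ (ihom A).obj K ≫ dualAct A K = (λ_ _).hom
        apply ihom_hom_ext
        rw [MonoidalCategory.whiskerLeft_comp, Category.assoc, ev_dualAct,
          associator_inv_naturality_middle_assoc, ← comp_whiskerRight_assoc, MonObj.mul_one]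
        simp
      mul_smul := by
        change (MonObj.mul : A ⊗ A ⟶ A) ▷ (ihom A).obj K ≫ dualAct A K =
          (α_ A A _).hom ≫ A ◁ dualAct A K ≫ dualAct A K
        apply ihom_hom_ext
        simp only [MonoidalCategory.whiskerLeft_comp, Category.assoc]
        rw [ev_dualAct, associator_inv_naturality_middle_assoc, ← comp_whiskerRight_assoc,
          MonObj.mul_assoc_flip, associator_inv_naturality_right_assoc, whisker_exchange_assoc,
          ev_dualAct, associator_inv_naturality_left_assoc]
        simp only [comp_whiskerRight, Category.assoc]
        rw [pentagon_hom_inv_inv_inv_inv_assoc] }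

/-- The form `D' A = A ⊸ K ⟶ 1 ⊸ K ≅ K` given by the dual of the unit of `A`. -/
def dualUnit : (ihom A).obj K ⟶ K :=
  (MonoidalClosed.pre (MonObj.one : 𝟙_ C ⟶ A)).app K ≫ (MonoidalClosed.unitIsoSelf K).hom

end DualModule

end GrothendieckVerdier

/-! An object `K` is dualizing exactly when every object occurs on the right, and every object on
the left, of a perfect pairing `L ⊗ R ⟶ K` (`IsDualizing.exists_equivalence_perfect`,
`isDualizing_of_perfect`). So perfect pairings of modules have to be built from those of `C`.

The module `A ⊸ K` is cofree: module maps into it are morphisms to `K`, via composition with `υ`.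
Hence module maps `M ⊗_A N ⟶ A ⊸ K` are the balanced morphisms `M ⊗ N ⟶ K` (`pairingEquiv`). Given a
perfect `e : L ⊗ R ⟶ K` with an `A`-action on one factor, the balancing equation has a unique
solution for the action on the other, and uniqueness gives the module axioms. For balanced perfect
`e`, a morphism into a factor is `A`-linear iff the pairing it induces is balanced, so the pairing
of modules is perfect too.

The forgetful functor thus carries perfect pairings to perfect pairings. Its duality transformations
send the transpose of the one to the transpose of the other; both transposes are invertible, hence
so are the transformations. -/

namespace GrothendieckVerdier

/-! ### Perfect pairings -/

section Perfect

variable {C : Type u} [Category.{v} C] [MonoidalCategory C] {K : C}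

/-- A pairing `e : L ⊗ R ⟶ K` is perfect if it exhibits `L` as representing `Hom(- ⊗ R, K)` and
`R` as representing `Hom(L ⊗ -, K)`. -/
structure IsPerfect {L R : C} (e : L ⊗ R ⟶ K) : Prop where
  left (X : C) : Function.Bijective fun f : X ⟶ L => f ▷ R ≫ e
  right (Y : C) : Function.Bijective fun g : Y ⟶ R => L ◁ g ≫ e

namespace IsPerfect

variable {L R : C} {e : L ⊗ R ⟶ K} (he : IsPerfect e)
include he

theorem left_ext {X : C} {f g : X ⟶ L} (h : f ▷ R ≫ e = g ▷ R ≫ e) : f = g :=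
  (he.left X).1 h

theorem right_ext {Y : C} {f g : Y ⟶ R} (h : L ◁ f ≫ e = L ◁ g ≫ e) : f = g :=
  (he.right Y).1 h

theorem exists_left {X : C} (h : X ⊗ R ⟶ K) : ∃ f : X ⟶ L, f ▷ R ≫ e = h :=
  (he.left X).2 h

theorem exists_right {Y : C} (h : L ⊗ Y ⟶ K) : ∃ g : Y ⟶ R, L ◁ g ≫ e = h :=
  (he.right Y).2 h

theorem whiskerRight_iso {L' : C} (w : L' ≅ L) : IsPerfect (w.hom ▷ R ≫ e) where
  left X := by
    have h : (fun f : X ⟶ L' => f ▷ R ≫ w.hom ▷ R ≫ e) =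
        (fun f : X ⟶ L => f ▷ R ≫ e) ∘ w.homToEquiv := by
      ext f
      simp
    rw [h]
    exact (he.left X).comp (Equiv.bijective _)
  right Y := by
    have h : (fun g : Y ⟶ R => L' ◁ g ≫ w.hom ▷ R ≫ e) =
        (fun h : L ⊗ Y ⟶ K => w.hom ▷ Y ≫ h) ∘ (fun g : Y ⟶ R => L ◁ g ≫ e) := by
      ext g
      simp [whisker_exchange_assoc]
    rw [h]
    refine Function.Bijective.comp ?_ (he.right Y)
    exact (((tensorRight Y).mapIso w).symm.homFromEquiv (Z := K)).bijective

/-- By Yoneda: postcomposition with `curry e` is right perfection followed by the currying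
bijection. Thus `R` is a model of `L ⊸ K`. -/
theorem isIso_curry [MonoidalClosed C] : IsIso (MonoidalClosed.curry e) := by
  have key (Y : C) (g : Y ⟶ R) :
      g ≫ MonoidalClosed.curry e = MonoidalClosed.curry (L ◁ g ≫ e) :=
    (MonoidalClosed.curry_natural_left g e).symm
  rw [isIso_iff_yoneda_map_bijective]
  intro Y
  have h : (fun g : Y ⟶ R => g ≫ MonoidalClosed.curry e) =
      MonoidalClosed.curry ∘ fun g : Y ⟶ R => L ◁ g ≫ e := by
    ext g
    exact key Y g
  rw [h]
  exact (((ihom.adjunction L).homEquiv Y K).bijective).comp (he.right Y)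

theorem isIso_rightCurry [RightClosed C] :
    IsIso ((RightClosed.rightAdj R).homEquiv L K e) := by
  rw [isIso_iff_yoneda_map_bijective]
  intro X
  have h : (fun f : X ⟶ L => f ≫ (RightClosed.rightAdj R).homEquiv L K e) =
      (RightClosed.rightAdj R).homEquiv X K ∘ fun f : X ⟶ L => f ▷ R ≫ e := by
    ext f
    exact ((RightClosed.rightAdj R).homEquiv_naturality_left f e).symm
  rw [h]
  exact (((RightClosed.rightAdj R).homEquiv X K).bijective).comp (he.left X)

end IsPerfect

/-- The universal element of the representation of `Hom(- ⊗ R, K)` is the pairing. Perfection on the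
right is full faithfulness of `D`, since `L ◁ g ≫ e` corresponds to `D.map g.op`. -/
theorem IsDualizing.exists_equivalence_perfect (hK : IsDualizing K) :
    ∃ D : Cᵒᵖ ⥤ C, D.IsEquivalence ∧
      ∀ R : C, ∃ e : D.obj (op R) ⊗ R ⟶ K, IsPerfect e := by
  obtain ⟨D, ⟨i⟩, hD⟩ := hK
  let E (Y X : C) : (X ⟶ D.obj (op Y)) ≃ (X ⊗ Y ⟶ K) := ((i.app (op Y)).app (op X)).toEquiv
  have hE (Y : C) {X X' : C} (f : X ⟶ X') (g : X' ⟶ D.obj (op Y)) :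
      E Y X (f ≫ g) = f ▷ Y ≫ E Y X' g :=
    ConcreteCategory.congr_hom ((i.hom.app (op Y)).naturality f.op) g
  have hN {Y Y' : C} (X : C) (f : Y' ⟶ Y) (g : X ⟶ D.obj (op Y)) :
      E Y' X (g ≫ D.map f.op) = X ◁ f ≫ E Y X g :=
    ConcreteCategory.congr_hom (NatTrans.congr_app (i.hom.naturality f.op) (op X)) g
  refine ⟨D, hD, fun R => ⟨E R _ (𝟙 _), fun X => ?_, fun Y => ?_⟩⟩
  · convert (E R X).bijective using 2 with f
    rw [← hE, Category.comp_id]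
  · convert (((opEquiv (op R) (op Y)).symm.trans
      (Functor.FullyFaithful.ofFullyFaithful D).homEquiv).trans (E Y _)).bijective using 2 with g
    rw [← hN, Category.id_comp]
    rfl

theorem IsDualizing.exists_perfect_left (hK : IsDualizing K) (R : C) :
    ∃ (L : C) (e : L ⊗ R ⟶ K), IsPerfect e := by
  obtain ⟨D, -, h⟩ := hK.exists_equivalence_perfect
  exact ⟨_, h R⟩

/-- Essential surjectivity of `D` gives `L ≅ D R`, along which the pairing is transported. -/
theorem IsDualizing.exists_perfect_right (hK : IsDualizing K) (L : C) :
    ∃ (R : C) (e : L ⊗ R ⟶ K), IsPerfect e := by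
  obtain ⟨D, hD, h⟩ := hK.exists_equivalence_perfect
  obtain ⟨e, he⟩ := h (D.objPreimage L).unop
  exact ⟨_, _, he.whiskerRight_iso (D.objObjPreimageIso L).symm⟩

/-- Left perfection defines the contravariant functor, right perfection makes it fully faithful, and
`hr` makes it essentially surjective. -/
theorem isDualizing_of_perfect (hl : ∀ R : C, ∃ (L : C) (e : L ⊗ R ⟶ K), IsPerfect e)
    (hr : ∀ L : C, ∃ (R : C) (e : L ⊗ R ⟶ K), IsPerfect e) : IsDualizing K := by
  choose L e he using hl
  -- The transpose of `g` with respect to the two pairings; it is the action of `D` on morphisms.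
  have hm (R R' : C) (g : R' ⟶ R) : ∃ f : L R ⟶ L R', f ▷ R' ≫ e R' = L R ◁ g ≫ e R :=
    (he R').exists_left _
  choose m hm using hm
  let D : Cᵒᵖ ⥤ C :=
    { obj R := L R.unop
      map g := m _ _ g.unop
      map_id R := (he _).left_ext (by simp [hm])
      map_comp f g := (he _).left_ext (by
        simp only [comp_whiskerRight, Category.assoc, hm, unop_comp,
          MonoidalCategory.whiskerLeft_comp]
        rw [← whisker_exchange_assoc, hm]) }
  have hD : D.FullyFaithful :=
    { preimage {R R'} f := ((he R.unop).exists_right (f ▷ R'.unop ≫ e R'.unop)).choose.op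
      map_preimage {R R'} f := (he R'.unop).left_ext ((hm _ _ _).trans
        ((he R.unop).exists_right (f ▷ R'.unop ≫ e R'.unop)).choose_spec)
      preimage_map {R R'} g := Quiver.Hom.unop_inj ((he R.unop).right_ext
        (((he R.unop).exists_right (m _ _ g.unop ▷ R'.unop ≫ e R'.unop)).choose_spec.trans
          (hm _ _ _))) }
  refine ⟨D, ⟨NatIso.ofComponents (fun R => NatIso.ofComponents (fun X =>
    (Equiv.ofBijective _ ((he R.unop).left X.unop)).toIso) ?_) ?_⟩,
    ⟨hD.faithful, hD.full, ⟨fun X => ?_⟩⟩⟩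
  · intro X Y f
    ext g
    simp [pairings]
  · intro R R' g
    ext X f
    change (f ≫ m _ _ g.unop) ▷ R'.unop ≫ e R'.unop = X.unop ◁ g.unop ≫ f ▷ R.unop ≫ e R.unop
    rw [comp_whiskerRight, Category.assoc, hm, whisker_exchange_assoc]
  -- `X` and the chosen `L R` both represent `Hom(- ⊗ R, K)`, hence are isomorphic.
  · obtain ⟨R, p, hp⟩ := hr X
    obtain ⟨f, hf⟩ := (he R).exists_left p
    obtain ⟨g, hg⟩ := hp.exists_left (e R)
    exact ⟨op R, ⟨⟨g, f, (he R).left_ext (by simp [hf, hg]), hp.left_ext (by simp [hf, hg])⟩⟩⟩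

end Perfect

/-! ### Duality transformations and transposes of pairings -/

section Functors

variable {C : Type u₁} [Category.{v₁} C] [MonoidalCategory C]
  {D : Type u₂} [Category.{v₂} D] [MonoidalCategory D] (F : C ⥤ D) [F.LaxMonoidal]

/-- `leftDuality` is itself the transpose of `μ ≫ F.map ev ≫ υ`, so this is naturality of `μ` and of
currying. It reduces invertibility of the duality to that of two transposes. -/
theorem map_curry_leftDuality [MonoidalClosed C] [MonoidalClosed D] {K : C} {k : D}
    (υ : F.obj K ⟶ k) {X Y : C} (p : X ⊗ Y ⟶ K) :
    F.map (MonoidalClosed.curry p) ≫ leftDuality F υ X =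
      MonoidalClosed.curry (Functor.LaxMonoidal.μ F X Y ≫ F.map p ≫ υ) := by
  have h : leftDuality F υ X = MonoidalClosed.curry
      (Functor.LaxMonoidal.μ F X ((ihom X).obj K) ≫ F.map ((ihom.ev X).app K) ≫ υ) := by
    simp [leftDuality, leftComparator, MonoidalClosed.curry_eq]
  rw [h, ← MonoidalClosed.curry_natural_left, Functor.LaxMonoidal.μ_natural_right_assoc,
    ← F.map_comp_assoc, MonoidalClosed.whiskerLeft_curry_ihom_ev_app]

theorem map_rightCurry_rightDuality [RightClosed C] [RightClosed D] {K : C} {k : D}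
    (υ : F.obj K ⟶ k) {X Y : C} (p : Y ⊗ X ⟶ K) :
    F.map ((RightClosed.rightAdj X).homEquiv Y K p) ≫ rightDuality F υ X =
      (RightClosed.rightAdj (F.obj X)).homEquiv (F.obj Y) k
        (Functor.LaxMonoidal.μ F Y X ≫ F.map p ≫ υ) := by
  have h : rightDuality F υ X = (RightClosed.rightAdj (F.obj X)).homEquiv _ _
      (Functor.LaxMonoidal.μ F ((RightClosed.rightHom X).obj K) X ≫
        F.map ((RightClosed.rightAdj X).counit.app K) ≫ υ) := by
    refine Eq.trans ?_ ((RightClosed.rightAdj (F.obj X)).homEquiv_unit _ _ _).symm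
    simp [rightDuality, rightComparator]
  have h' : (RightClosed.rightAdj X).homEquiv Y K p ▷ X ≫
      (RightClosed.rightAdj X).counit.app K = p :=
    ((RightClosed.rightAdj X).homEquiv_counit _ _ _).symm.trans (Equiv.symm_apply_apply _ _)
  rw [h, ← Adjunction.homEquiv_naturality_left]
  congr 1
  rw [← h', F.map_comp, Category.assoc, h', ← Functor.LaxMonoidal.μ_natural_left_assoc]
  rfl

end Functors

/-! ### Pairings of modules -/

section DualModule

variable {C : Type u} [Category.{v} C] [MonoidalCategory C] [MonoidalClosed C]
  {A : C} [MonObj A] {K : C}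

/-- The form `υ` is evaluation at the unit of `A`. -/
theorem dualUnit_eq : dualUnit A K =
    (λ_ _).inv ≫ (MonObj.one : 𝟙_ C ⟶ A) ▷ (ihom A).obj K ≫ (ihom.ev A).app K := by
  -- `unitIsoSelf` is conjugate to the left unitor under the adjunctions, which determines its
  -- inverse after evaluation.
  have h : 𝟙_ C ◁ (MonoidalClosed.unitIsoSelf K).inv ≫ (ihom.ev (𝟙_ C)).app K = (λ_ K).hom :=
    (conjugateEquiv_counit (Adjunction.id (C := C)) (ihom.adjunction (𝟙_ C))
      (leftUnitorNatIso C).hom K).trans (Category.comp_id _)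
  have h' : (MonoidalClosed.unitIsoSelf K).hom = (λ_ _).inv ≫ (ihom.ev (𝟙_ C)).app K := by
    rw [← cancel_epi (MonoidalClosed.unitIsoSelf K).inv, Iso.inv_hom_id,
      leftUnitor_inv_naturality_assoc, h, Iso.inv_hom_id]
  rw [dualUnit, h', leftUnitor_inv_naturality_assoc, MonoidalClosed.id_tensor_pre_app_comp_ev]

/-- In element notation, `(a • φ)(x) = φ(x a)`; put `x = 1`. -/
theorem dualAct_dualUnit : dualAct A K ≫ dualUnit A K = (ihom.ev A).app K := by
  rw [dualUnit_eq, leftUnitor_inv_naturality_assoc, whisker_exchange_assoc, ev_dualAct,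
    associator_inv_naturality_left_assoc, ← comp_whiskerRight_assoc, MonObj.one_mul]
  simp

/-- Module maps into `A ⊸ K` are the same as morphisms to `K`. -/
theorem bijective_comp_dualUnit (P : Mod C A) :
    Function.Bijective fun f : P ⟶ dualModule A K =>
      (f.hom : P.X ⟶ (ihom A).obj K) ≫ dualUnit A K := by
  -- Linearity recovers `f` from `h = f ≫ υ`, as `f(x)(a) = h(a x)`. This gives injectivity and
  -- dictates the preimage `curry (leftAct P ≫ h)` below.
  have key (f : P ⟶ dualModule A K) :
      A ◁ f.hom ≫ (ihom.ev A).app K = leftAct P ≫ f.hom ≫ dualUnit A K := by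
    rw [← dualAct_dualUnit]
    have := leftAct_hom f
    exact ((Category.assoc _ _ _).symm.trans (congrArg (· ≫ dualUnit A K) this.symm)).trans
      (Category.assoc _ _ _)
  constructor
  · intro f g h
    apply Mod.hom_ext
    apply ihom_hom_ext
    exact (key f).trans ((congrArg (leftAct P ≫ ·) h).trans (key g).symm)
  · intro h
    have hc : A ◁ MonoidalClosed.curry (leftAct P ≫ h) ≫ (ihom.ev A).app K = leftAct P ≫ h :=
      MonoidalClosed.whiskerLeft_curry_ihom_ev_app _ _ _
    refine ⟨Mod.Hom.mk' (MonoidalClosed.curry (leftAct P ≫ h)) ?_, ?_⟩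
    · change leftAct P ≫ MonoidalClosed.curry (leftAct P ≫ h) =
        A ◁ MonoidalClosed.curry (leftAct P ≫ h) ≫ dualAct A K
      apply ihom_hom_ext
      simp only [MonoidalCategory.whiskerLeft_comp, Category.assoc]
      rw [hc, ev_dualAct, associator_inv_naturality_right_assoc, whisker_exchange_assoc, hc,
        reassoc_of% (mul_leftAct P), Iso.inv_hom_id_assoc]
    · change MonoidalClosed.curry (leftAct P ≫ h) ≫ dualUnit A K = h
      rw [dualUnit_eq, leftUnitor_inv_naturality_assoc, whisker_exchange_assoc, hc,
        reassoc_of% (one_leftAct P), Iso.inv_hom_id_assoc]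

end DualModule

/-! ### Balanced pairings and transport of actions -/

section Balanced

variable {C : Type u} [Category.{v} C] [MonoidalCategory C] [BraidedCategory C]
  {A : C} [MonObj A] {K : C}

/-- A pairing `M ⊗ N ⟶ K` of modules is balanced if it coequalizes the right action on `M`
and the left action on `N`. -/
def IsBalanced (M N : Mod C A) (e : M.X ⊗ N.X ⟶ K) : Prop :=
  rightAct M ▷ N.X ≫ e = (α_ M.X A N.X).hom ≫ M.X ◁ leftAct N ≫ e

theorem rightAct_hom_iff {M N : Mod C A} (f : M.X ⟶ N.X) :
    rightAct M ≫ f = f ▷ A ≫ rightAct N ↔ leftAct M ≫ f = A ◁ f ≫ leftAct N := by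
  rw [rightAct, rightAct, BraidedCategory.braiding_naturality_left_assoc, Category.assoc,
    cancel_epi]

theorem one_rightAct (M : Mod C A) :
    M.X ◁ (MonObj.one : 𝟙_ C ⟶ A) ≫ rightAct M = (ρ_ M.X).hom := by
  rw [rightAct, BraidedCategory.braiding_naturality_right_assoc, one_leftAct]
  simp

theorem rightAct_mul [IsCommMonObj A] (M : Mod C A) :
    M.X ◁ (MonObj.mul : A ⊗ A ⟶ A) ≫ rightAct M =
      (α_ M.X A A).inv ≫ rightAct M ▷ A ≫ rightAct M :=
  ((toBimod A).obj M).right_assoc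

/-- A left module over a commutative algebra from a right module, by the inverse braiding. -/
def modOfRight [IsCommMonObj A] (L : C) (r : L ⊗ A ⟶ L)
    (h₁ : L ◁ (MonObj.one : 𝟙_ C ⟶ A) ≫ r = (ρ_ L).hom)
    (h₂ : L ◁ (MonObj.mul : A ⊗ A ⟶ A) ≫ r = (α_ L A A).inv ≫ r ▷ A ≫ r) : Mod C A where
  X := L
  mod :=
    { smul := (β_ L A).inv ≫ r
      one_smul := by
        change (MonObj.one : 𝟙_ C ⟶ A) ▷ L ≫ (β_ L A).inv ≫ r = (λ_ L).hom
        rw [BraidedCategory.braiding_inv_naturality_left_assoc, h₁]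
        simp
      mul_smul := by
        change (MonObj.mul : A ⊗ A ⟶ A) ▷ L ≫ (β_ L A).inv ≫ r =
          (α_ A A L).hom ≫ A ◁ ((β_ L A).inv ≫ r) ≫ (β_ L A).inv ≫ r
        -- Passing from right to left actions reverses the order of multiplication; commutativity
        -- restores it.
        have h : (β_ A A).inv ≫ (MonObj.mul : A ⊗ A ⟶ A) = MonObj.mul := by
          rw [Iso.inv_comp_eq, IsCommMonObj.mul_comm]
        rw [BraidedCategory.braiding_inv_naturality_left_assoc, ← h,
          MonoidalCategory.whiskerLeft_comp, Category.assoc, h₂,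
          MonoidalCategory.whiskerLeft_comp, Category.assoc,
          BraidedCategory.braiding_inv_naturality_right_assoc,
          BraidedCategory.braiding_tensor_right_inv, BraidedCategory.braiding_tensor_left_inv]
        simp }

theorem rightAct_modOfRight [IsCommMonObj A] (L : C) (r : L ⊗ A ⟶ L)
    (h₁ : L ◁ (MonObj.one : 𝟙_ C ⟶ A) ≫ r = (ρ_ L).hom)
    (h₂ : L ◁ (MonObj.mul : A ⊗ A ⟶ A) ≫ r = (α_ L A A).inv ≫ r ▷ A ≫ r) :
    rightAct (modOfRight L r h₁ h₂) = r :=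
  Iso.hom_inv_id_assoc _ _

theorem IsPerfect.exists_mod_left [IsCommMonObj A] {L : C} (N : Mod C A) {e : L ⊗ N.X ⟶ K}
    (he : IsPerfect e) :
    ∃ (M : Mod C A) (e' : M.X ⊗ N.X ⟶ K), IsPerfect e' ∧ IsBalanced M N e' := by
  -- The balancing equation, solved for the right action `r`. The module axioms are then checked
  -- after pairing with `N`, where they become those of `N`.
  obtain ⟨r, hr⟩ := he.exists_left ((α_ L A N.X).hom ≫ L ◁ leftAct N ≫ e)
  refine ⟨modOfRight L r (he.left_ext ?_) (he.left_ext ?_), e, he, ?_⟩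
  · rw [comp_whiskerRight, Category.assoc, hr, associator_naturality_middle_assoc,
      ← MonoidalCategory.whiskerLeft_comp_assoc, one_leftAct]
    simp
  · simp only [comp_whiskerRight, Category.assoc]
    rw [hr, associator_naturality_middle_assoc,
      ← MonoidalCategory.whiskerLeft_comp_assoc, mul_leftAct, associator_naturality_left_assoc,
      ← whisker_exchange_assoc, hr]
    simp
  · unfold IsBalanced
    rw [rightAct_modOfRight]
    exact hr

theorem IsPerfect.exists_mod_right [IsCommMonObj A] {R : C} (M : Mod C A) {e : M.X ⊗ R ⟶ K}
    (he : IsPerfect e) :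
    ∃ (N : Mod C A) (e' : M.X ⊗ N.X ⟶ K), IsPerfect e' ∧ IsBalanced M N e' := by
  obtain ⟨l, hl⟩ := he.exists_right ((α_ M.X A R).inv ≫ rightAct M ▷ R ≫ e)
  refine ⟨{ X := R, mod := ⟨l, he.right_ext ?_, he.right_ext ?_⟩ }, e, he, ?_⟩
  · change M.X ◁ ((MonObj.one : 𝟙_ C ⟶ A) ▷ R ≫ l) ≫ e = M.X ◁ (λ_ R).hom ≫ e
    rw [MonoidalCategory.whiskerLeft_comp, Category.assoc, hl,
      associator_inv_naturality_middle_assoc, ← comp_whiskerRight_assoc, one_rightAct]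
    simp
  · change M.X ◁ ((MonObj.mul : A ⊗ A ⟶ A) ▷ R ≫ l) ≫ e =
      M.X ◁ ((α_ A A R).hom ≫ A ◁ l ≫ l) ≫ e
    simp only [MonoidalCategory.whiskerLeft_comp, Category.assoc]
    rw [hl, associator_inv_naturality_middle_assoc, ← comp_whiskerRight_assoc, rightAct_mul,
      associator_inv_naturality_right_assoc, whisker_exchange_assoc, hl]
    simp
  · change rightAct M ▷ R ≫ e = (α_ M.X A R).hom ≫ M.X ◁ l ≫ e
    rw [hl, Iso.hom_inv_id_assoc]

/-- Since `e` is balanced, the two sides of the balancing equation for `f ▷ N.X ≫ e` are the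
pairings induced by `rightAct P ≫ f` and `f ▷ A ≫ rightAct M`; perfection cancels `e`. -/
theorem IsBalanced.whiskerRight_iff {M N P : Mod C A} {e : M.X ⊗ N.X ⟶ K}
    (hb : IsBalanced M N e) (he : IsPerfect e) (f : P.X ⟶ M.X) :
    IsBalanced P N (f ▷ N.X ≫ e) ↔ leftAct P ≫ f = A ◁ f ≫ leftAct M := by
  rw [← rightAct_hom_iff, ← (he.left _).1.eq_iff]
  dsimp only [IsBalanced] at *
  simp only [comp_whiskerRight, Category.assoc, hb]
  rw [whisker_exchange_assoc]
  simp

theorem IsBalanced.whiskerLeft_iff {M N P : Mod C A} {e : M.X ⊗ N.X ⟶ K}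
    (hb : IsBalanced M N e) (he : IsPerfect e) (f : P.X ⟶ N.X) :
    IsBalanced M P (M.X ◁ f ≫ e) ↔ leftAct P ≫ f = A ◁ f ≫ leftAct N := by
  rw [← (he.right _).1.eq_iff]
  dsimp only [IsBalanced] at *
  rw [← cancel_epi (α_ M.X A P.X).hom, eq_comm]
  simp only [MonoidalCategory.whiskerLeft_comp, Category.assoc]
  rw [← associator_naturality_right_assoc, ← hb, whisker_exchange_assoc]

end Balanced

/-! ### Perfect pairings over `A` and the forgetful functor -/

section Modules

variable {C : Type u} [Category.{v} C] [MonoidalCategory C] [BraidedCategory C]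
  [MonoidalClosed C] [RightClosed C] [HasCoequalizers C]
  {A : C} [MonObj A] [IsCommMonObj A] {K : C}

theorem isBalanced_modProj_comp (M N : Mod C A) (h : (M ⊗ N).X ⟶ K) :
    IsBalanced M N (modProj A M N ≫ h) := by
  have := coequalizer.condition (rightAct M ▷ N.X) ((α_ M.X A N.X).hom ≫ M.X ◁ leftAct N)
  have := this =≫ h
  exact ((Category.assoc _ _ _).symm.trans this).trans
    ((Category.assoc _ _ _).trans (Category.assoc _ _ _))

/-- Module maps `M ⊗_A N ⟶ A ⊸ K` are the same as balanced pairings `M ⊗ N ⟶ K`. -/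
noncomputable def pairingEquiv (M N : Mod C A) :
    (M ⊗ N ⟶ dualModule A K) ≃ { e : M.X ⊗ N.X ⟶ K // IsBalanced M N e } :=
  (Equiv.ofBijective _ (bijective_comp_dualUnit (M ⊗ N))).trans
    { toFun h := ⟨modProj A M N ≫ h, isBalanced_modProj_comp M N h⟩
      invFun e := coequalizer.desc e.1 (e.2.trans (Category.assoc _ _ _).symm)
      left_inv _ := coequalizer.hom_ext (coequalizer.π_desc _ _)
      right_inv _ := Subtype.ext (coequalizer.π_desc _ _) }

theorem pairingEquiv_coe (M N : Mod C A) (p : M ⊗ N ⟶ dualModule A K) :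
    (pairingEquiv M N p).1 = modProj A M N ≫ (p.hom : (M ⊗ N).X ⟶ (ihom A).obj K) ≫ dualUnit A K :=
  rfl

theorem pairingEquiv_whiskerRight {M M' : Mod C A} (N : Mod C A) (f : M' ⟶ M)
    (p : M ⊗ N ⟶ dualModule A K) :
    (pairingEquiv M' N (f ▷ N ≫ p)).1 = f.hom ▷ N.X ≫ (pairingEquiv M N p).1 := by
  have h : f.hom ▷ N.X ≫ modProj A M N = modProj A M' N ≫ (f ▷ N).hom :=
    Functor.LaxMonoidal.μ_natural_left (Mod.forget (D := C) A) f N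
  rw [pairingEquiv_coe, pairingEquiv_coe, reassoc_of% h]
  exact congrArg (_ ≫ ·) (Category.assoc _ _ _)

theorem pairingEquiv_whiskerLeft (M : Mod C A) {N N' : Mod C A} (f : N' ⟶ N)
    (p : M ⊗ N ⟶ dualModule A K) :
    (pairingEquiv M N' (M ◁ f ≫ p)).1 = M.X ◁ f.hom ≫ (pairingEquiv M N p).1 := by
  have h : M.X ◁ f.hom ≫ modProj A M N = modProj A M N' ≫ (M ◁ f).hom :=
    Functor.LaxMonoidal.μ_natural_right (Mod.forget (D := C) A) M f
  rw [pairingEquiv_coe, pairingEquiv_coe, reassoc_of% h]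
  exact congrArg (_ ≫ ·) (Category.assoc _ _ _)

/-- The bijections for `p` are those of the underlying pairing in `C`, restricted to linear maps on
one side and balanced pairings on the other; the `whiskerRight_iff` and `whiskerLeft_iff` criteria
match these. -/
theorem isPerfect_of_pairingEquiv {M N : Mod C A} (p : M ⊗ N ⟶ dualModule A K)
    (he : IsPerfect (pairingEquiv M N p).1) : IsPerfect p where
  left P := by
    have hb := (pairingEquiv M N p).2
    constructor
    · intro f g h
      apply Mod.hom_ext
      apply he.left_ext
      rw [← pairingEquiv_whiskerRight, ← pairingEquiv_whiskerRight]
      exact congrArg (fun q => (pairingEquiv P N q).1) h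
    · intro q
      obtain ⟨f, hf⟩ := he.exists_left (pairingEquiv P N q).1
      refine ⟨Mod.Hom.mk' f ((hb.whiskerRight_iff he f).1 (hf ▸ (pairingEquiv P N q).2)), ?_⟩
      apply (pairingEquiv P N).injective
      apply Subtype.ext
      exact (pairingEquiv_whiskerRight _ _ _).trans hf
  right P := by
    have hb := (pairingEquiv M N p).2
    constructor
    · intro f g h
      apply Mod.hom_ext
      apply he.right_ext
      rw [← pairingEquiv_whiskerLeft, ← pairingEquiv_whiskerLeft]
      exact congrArg (fun q => (pairingEquiv M P q).1) h
    · intro q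
      obtain ⟨f, hf⟩ := he.exists_right (pairingEquiv M P q).1
      refine ⟨Mod.Hom.mk' f ((hb.whiskerLeft_iff he f).1 (hf ▸ (pairingEquiv M P q).2)), ?_⟩
      apply (pairingEquiv M P).injective
      apply Subtype.ext
      exact (pairingEquiv_whiskerLeft _ _ _).trans hf

/-- Perfection is recorded for the underlying pairing in `C`: it implies perfection of `p`, and the
duality of the forgetful functor needs both. -/
theorem exists_pairing_left (hK : IsDualizing K) (N : Mod C A) :
    ∃ (M : Mod C A) (p : M ⊗ N ⟶ dualModule A K),
      IsPerfect (pairingEquiv M N p).1 := by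
  obtain ⟨L, e, he⟩ := hK.exists_perfect_left N.X
  obtain ⟨M, e', he', hb⟩ := he.exists_mod_left N
  refine ⟨M, (pairingEquiv M N).symm ⟨e', hb⟩, ?_⟩
  rwa [Equiv.apply_symm_apply]

theorem exists_pairing_right (hK : IsDualizing K) (M : Mod C A) :
    ∃ (N : Mod C A) (p : M ⊗ N ⟶ dualModule A K),
      IsPerfect (pairingEquiv M N p).1 := by
  obtain ⟨R, e, he⟩ := hK.exists_perfect_right M.X
  obtain ⟨N, e', he', hb⟩ := he.exists_mod_right M
  refine ⟨N, (pairingEquiv M N).symm ⟨e', hb⟩, ?_⟩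
  rwa [Equiv.apply_symm_apply]

theorem isDualizing_dualModule (hK : IsDualizing K) : IsDualizing (dualModule A K) :=
  isDualizing_of_perfect
    (fun N => by
      obtain ⟨M, p, hp⟩ := exists_pairing_left (A := A) hK N
      exact ⟨M, p, isPerfect_of_pairingEquiv p hp⟩)
    (fun M => by
      obtain ⟨N, p, hp⟩ := exists_pairing_right (A := A) hK M
      exact ⟨N, p, isPerfect_of_pairingEquiv p hp⟩)

/-- Composing with the invertible transpose of `p` yields the transpose of the underlying perfect
pairing, also invertible. The closed structure on modules is arbitrary, so the one chosen from the
GV-structure is covered. -/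
theorem isIso_leftDuality_forget [MonoidalClosed (Mod C A)] (hK : IsDualizing K) (M : Mod C A) :
    IsIso (leftDuality (K := dualModule A K) (k := K) (Mod.forget (D := C) A) (dualUnit A K) M) := by
  obtain ⟨N, p, hp⟩ := exists_pairing_right (A := A) hK M
  have h₁ := (isPerfect_of_pairingEquiv p hp).isIso_curry
  have h₂ := hp.isIso_curry
  have h : (Mod.forget (D := C) A).map (MonoidalClosed.curry p) ≫
      leftDuality (K := dualModule A K) (k := K) (Mod.forget (D := C) A) (dualUnit A K) M =
      MonoidalClosed.curry (pairingEquiv M N p).1 := by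
    exact map_curry_leftDuality _ _ _
  exact (isIso_comp_left_iff ((Mod.forget (D := C) A).map (MonoidalClosed.curry p)) _).1
    (h ▸ h₂)

theorem isIso_rightDuality_forget [RightClosed (Mod C A)] (hK : IsDualizing K) (N : Mod C A) :
    IsIso (rightDuality (K := dualModule A K) (k := K) (Mod.forget (D := C) A) (dualUnit A K) N) := by
  obtain ⟨M, p, hp⟩ := exists_pairing_left (A := A) hK N
  have h₁ := (isPerfect_of_pairingEquiv p hp).isIso_rightCurry
  have h₂ := hp.isIso_rightCurry
  have h : (Mod.forget (D := C) A).map ((RightClosed.rightAdj N).homEquiv _ _ p) ≫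
      rightDuality (K := dualModule A K) (k := K) (Mod.forget (D := C) A) (dualUnit A K) N =
      (RightClosed.rightAdj N.X).homEquiv _ _ (pairingEquiv M N p).1 := by
    exact map_rightCurry_rightDuality _ _ _
  exact (isIso_comp_left_iff ((Mod.forget (D := C) A).map
    ((RightClosed.rightAdj N).homEquiv _ _ p)) _).1 (h ▸ h₂)

end Modules

end GrothendieckVerdier

theorem mainTheorem7 {C : Type u} [Category.{v} C] [MonoidalCategory C] [BraidedCategory C]
    [GrothendieckVerdier.GVCategory C] [HasEqualizers C] [HasCoequalizers C]
    (A : C) [MonObj A] [IsCommMonObj A] :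
    ∃ h : GrothendieckVerdier.IsDualizing
        (GrothendieckVerdier.dualModule A (GrothendieckVerdier.GVCategory.dualizingObj (C := C))),
      letI : GrothendieckVerdier.GVCategory (Mod C A) :=
        { dualizingObj := GrothendieckVerdier.dualModule A
            (GrothendieckVerdier.GVCategory.dualizingObj (C := C))
          isDualizing := h }
      GrothendieckVerdier.IsGVFunctor (Mod.forget (D := C) A)
        (GrothendieckVerdier.dualUnit A GrothendieckVerdier.GVCategory.dualizingObj) := by
  have hK := GrothendieckVerdier.GVCategory.isDualizing (C := C)
  refine ⟨GrothendieckVerdier.isDualizing_dualModule hK, ?_⟩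
  let _ : GrothendieckVerdier.GVCategory (Mod C A) :=
    { dualizingObj := GrothendieckVerdier.dualModule A
        (GrothendieckVerdier.GVCategory.dualizingObj (C := C))
      isDualizing := GrothendieckVerdier.isDualizing_dualModule hK }
  exact ⟨fun M => GrothendieckVerdier.isIso_leftDuality_forget hK M,
    fun N => GrothendieckVerdier.isIso_rightDuality_forget hK N⟩
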